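/- **Setting.** Let $\mathcal A$ be the finite set of agents of a connected undirected graph $\mathcal G$ with diameter $d(\mathcal G)$, and let the finite ground set $\mathcal P$ be the disjoint union of the agents' strategy sets $\mathcal P_i$. Let $1\le\kappa_i\le|\mathcal P_i|$ be integers and $\kappa=\sum_{i}\kappa_i$. Let $f:2^{\mathcal P}\to\mathbb R_{\ge0}$ be monotone increasing and submodular, and put $\Delta_f(p\mid S)=f(S\cup\{p\})-f(S)$. Let $c=1-\min_{S,\,p\notin S}\Delta_f(p\mid S)/\Delta_f(p\mid\emptyset)$ be its total curvature (a ratio with $\Delta_f(p\mid\emptyset)=0$ counts as $1$). Let $\mathcal R^\star$ maximize $f(\mathcal R)$ over all $\mathcal R\subseteq\mathcal P$ with $|\mathcal R\cap\mathcal P_i|\le\kappa_i$ for all $i$. For $\mathbf x\in[0,1]^{\mathcal P}$ let $\mathcal R_{\mathbf x}$ be the random set that contains each $p\in\mathcal P$ independently with probability $[\mathbf x]_p$, and let $$F(\mathbf x)=\mathbb E[f(\mathcal R_{\mathbf x})]=\sum_{\mathcal R\subseteq\mathcal P}f(\mathcal R)\prod_{p\in\mathcal R}[\mathbf x]_p\prod_{p\notin\mathcal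 R}(1-[\mathbf x]_p)$$ be the multilinear extension of $f$. **Algorithm.** Let $T\ge1$ and $K_i\ge1$ ($i\in\mathcal A$) be integers. Every agent starts at $\mathbf x_i(0)=\mathbf 0$. At each step $t=0,\dots,T-1$: 1. Each agent $i$ draws $K_i$ samples $\mathcal R_i^1(t),\dots,\mathcal R_i^{K_i}(t)$ of $\mathcal R_{\mathbf x_i(t)}$; given the history before step $t$, all samples of all agents are independent. It forms the empirical gradient $[\widetilde{\nabla F}(\mathbf x_i(t))]_p=\frac1{K_i}\sum_{k=1}^{K_i}\big(f(\mathcal R_i^k(t)\cup\{p\})-f(\mathcal R_i^k(t)\setminus\{p\})\big)$, $p\in\mathcal P$. 2. It chooses a maximizer $\widetilde{\mathbf v}_i(t)$ of $\mathbf w\mapsto\mathbf w\cdot\widetilde{\nabla F}(\mathbf x_i(t))$ over $\mathcal M_i=\{\mathbf w\in[0,1]^{\mathcal P}:\ \mathbf 1\cdot\mathbf w\le\kappa_i,\ [\mathbf w]_p=0\text{ for }p\notin\mathcal P_i\}$ (any selection among several maximizers is allowed) and propagates $\mathbf x_i^-(t+1)=\mathbf x_i(t)+\frac1T\widetilde{\mathbf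 v}_i(t)$. 3. It updates $\mathbf x_i(t+1)=\max_{j\in\mathcal N_i\cup\{i\}}\mathbf x_j^-(t+1)$ element-wise, where $\mathcal N_i$ is the set of neighbours of $i$. Let $\bar{\mathbf x}(T)=\max_{i\in\mathcal A}\mathbf x_i(T)$ (element-wise). **Theorem (Optimality gap).** Suppose that the numbers of samples are large enough that $2\,|\mathcal P_i|\,e^{-K_i/(8T^2)}\le1$ for every $i\in\mathcal A$. Then the inequality $$F(\bar{\mathbf x}(T))\ \ge\ \frac1c\,(1-e^{-c})\Big(1-\big(2c\,\kappa\,d(\mathcal G)+\tfrac{c\,\kappa}{2}+1\big)\frac{\kappa}{T}\Big)f(\mathcal R^\star)$$ (where $\frac1c(1-e^{-c})$ is read as its limit $1$ if $c=0$) holds with probability at least $$\Big(\prod_{i\in\mathcal A}\big(1-2e^{-K_i/(8T^2)}\big)^{|\mathcal P_i|}\Big)^{T}.$$ -/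

import Mathlib

open MeasureTheory ProbabilityTheory

namespace DistSubmod

noncomputable section

/-! ### Set functions on a finite ground set -/

/-- The marginal value `Δ_f(p | S) = f (S ∪ {p}) - f S`. -/
def marginal {P : Type*} [DecidableEq P] (f : Finset P → ℝ) (p : P) (S : Finset P) : ℝ :=
  f (insert p S) - f S

/-- Submodularity: marginal values decrease as the set grows. -/
def IsSubmodular {P : Type*} [DecidableEq P] (f : Finset P → ℝ) : Prop :=
  ∀ S₁ S₂ : Finset P, S₁ ⊆ S₂ → ∀ p, p ∉ S₂ → marginal f p S₂ ≤ marginal f p S₁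

/-- The ratio `Δ_f(p | S) / Δ_f(p | ∅)`; an element with `Δ_f(p | ∅) = 0` has the ratio `1`
(for a monotone submodular `f` it has no marginal value at all and does not influence the
curvature). -/
def marginalRatio {P : Type*} [DecidableEq P] (f : Finset P → ℝ) (p : P) (S : Finset P) : ℝ :=
  if marginal f p ∅ = 0 then 1 else marginal f p S / marginal f p ∅

/-- The total curvature `c = 1 - min_{S, p ∉ S} Δ_f(p | S) / Δ_f(p | ∅)`. -/
def curvature {P : Type*} [DecidableEq P] (f : Finset P → ℝ) : ℝ :=
  1 - ⨅ a : {a : P × Finset P // a.1 ∉ a.2}, marginalRatio f a.1.1 a.1.2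

/-- `(1 / c) (1 - e^{-c})`, with its limit value `1` at `c = 0`. -/
def curvatureFactor (c : ℝ) : ℝ :=
  if c = 0 then 1 else 1 / c * (1 - Real.exp (-c))

/-- The probability that the random set `R_x`, which contains each `p` independently with
probability `x p`, is equal to `R`. -/
def setProb {P : Type*} [Fintype P] [DecidableEq P] (x : P → ℝ) (R : Finset P) : ℝ :=
  (∏ p ∈ R, x p) * ∏ p ∈ Rᶜ, (1 - x p)

/-- The multilinear extension `F` of `f`. -/
def multilinearExt {P : Type*} [Fintype P] [DecidableEq P] (f : Finset P → ℝ) (x : P → ℝ) : ℝ :=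
  ∑ R : Finset P, f R * setProb x R

/-! ### The partition matroid constraint -/

/-- The strategy set `P_i` of agent `i`; `owner p` is the agent that owns the strategy `p`. -/
def strategySet {A P : Type*} [Fintype P] [DecidableEq A] (owner : P → A) (i : A) : Finset P :=
  {p | owner p = i}

/-- The feasible sets: at most `κ i` strategies of each agent `i`. -/
def feasible {A P : Type*} [Fintype P] [DecidableEq A] [DecidableEq P]
    (owner : P → A) (κ : A → ℕ) : Set (Finset P) :=
  {R | ∀ i, (R ∩ strategySet owner i).card ≤ κ i}

/-- `Rstar` maximizes `f` over the feasible sets. -/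
def IsOptimizer {A P : Type*} [Fintype P] [DecidableEq A] [DecidableEq P]
    (owner : P → A) (κ : A → ℕ) (f : Finset P → ℝ) (Rstar : Finset P) : Prop :=
  Rstar ∈ feasible owner κ ∧ ∀ R ∈ feasible owner κ, f R ≤ f Rstar

/-- The polytope `M_i`: vectors in `[0,1]^P` of total mass at most `κ i` that vanish off `P_i`. -/
def localPolytope {A P : Type*} [Fintype P] (owner : P → A) (κ : A → ℕ) (i : A) :
    Set (P → ℝ) :=
  {w | (∀ p, w p ∈ Set.Icc (0 : ℝ) 1) ∧ ∑ p, w p ≤ κ i ∧ ∀ p, owner p ≠ i → w p = 0}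

/-! ### The distributed algorithm -/

/-- The empirical gradient computed from the samples `R 0, …, R (K - 1)`. -/
def empiricalGrad {P : Type*} [DecidableEq P] (f : Finset P → ℝ) {K : ℕ}
    (R : Fin K → Finset P) (p : P) : ℝ :=
  (∑ k, (f (insert p (R k)) - f ((R k).erase p))) / K

/-- Element-wise maximum over the closed neighbourhood of `i`. -/
def neighborMax {A P : Type*} (G : SimpleGraph A) (y : A → P → ℝ) (i : A) : P → ℝ :=
  fun p => ⨆ j : {j : A // j = i ∨ G.Adj i j}, y j p

/-- Element-wise maximum over all agents. -/
def agentMax {A P : Type*} (y : A → P → ℝ) : P → ℝ :=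
  fun p => ⨆ i, y i p

/-- A run of length `T` of the distributed algorithm on a probability space `(Ω, μ)`.
`ℱ t` is the history before the samples of step `t` are drawn; `x t i` is the membership
probability vector of agent `i` at time `t`, `R t i k` is the `k`-th sample that agent `i` draws
at step `t`, and `v t i` is its ascent direction. Any rule, even a randomized one, may be used
to select a maximizer `v t i` when there are several. -/
structure IsRun {A P Ω : Type*} [Fintype A] [Fintype P] [DecidableEq P] [MeasurableSpace Ω]
    (μ : Measure Ω) (ℱ : Filtration ℕ ‹MeasurableSpace Ω›) (G : SimpleGraph A)
    (owner : P → A) (κ : A → ℕ) (f : Finset P → ℝ) (T : ℕ) (K : A → ℕ)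
    (x : ℕ → A → Ω → P → ℝ) (R : ℕ → (i : A) → Fin (K i) → Ω → Finset P)
    (v : ℕ → A → Ω → P → ℝ) : Prop where
  /-- All agents start at the zero vector. -/
  init : ∀ i ω, x 0 i ω = 0
  /-- The samples of step `t` belong to the history at time `t + 1`. -/
  sample_meas : ∀ t < T, ∀ i k S, MeasurableSet[ℱ (t + 1)] {ω | R t i k ω = S}
  /-- The directions of step `t` belong to the history at time `t + 1`. -/
  direction_meas : ∀ t < T, ∀ i, Measurable[ℱ (t + 1)] (v t i)
  /-- Given the history, the samples of step `t` are independent, over all agents `i` and all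
  `k`, and each sample of agent `i` is distributed as the random set of `x t i`. -/
  sample_law : ∀ t < T, ∀ E : Set Ω, MeasurableSet[ℱ t] E →
    ∀ S : (i : A) → Fin (K i) → Finset P,
      μ.real (E ∩ {ω | ∀ i k, R t i k ω = S i k}) =
        ∫ ω in E, ∏ i, ∏ k, setProb (x t i ω) (S i k) ∂μ
  /-- `v t i` maximizes `w ↦ w . g` over `M_i`, with `g` the empirical gradient of agent `i`. -/
  direction_mem : ∀ t < T, ∀ i ω, v t i ω ∈ localPolytope owner κ i
  direction_max : ∀ t < T, ∀ i ω, ∀ w ∈ localPolytope owner κ i,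
    ∑ p, w p * empiricalGrad f (fun k => R t i k ω) p ≤
      ∑ p, v t i ω p * empiricalGrad f (fun k => R t i k ω) p
  /-- Propagation by `x⁻_j (t + 1) = x_j (t) + v_j (t) / T`, then the maximum over the agent
  itself and its neighbours. -/
  update : ∀ t < T, ∀ i ω,
    x (t + 1) i ω = neighborMax G (fun j p => x t j ω p + (1 / (T : ℝ)) * v t j ω p) i

end

end DistSubmod

/-! The proof separates a deterministic analysis, valid while all gradient estimates are accurate,
from a lower bound on the probability of accuracy.

Write k for the sum of the `κ i`, d for the diameter and B = f(R*) - f(∅). The owner of p always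
holds the largest copy of coordinate p, so the agents' maximum z(t) consists of the owners' values
and moves by exactly 1/T times the owners' directions (`IsTrajectory.owner_succ`), while every agent
lags behind it by at most d k/T in total (`IsTrajectory.sum_lag_le`). Averaging
`gap_le_sum_discreteDeriv` over the random set shows that the partial derivatives of F at z over R*
sum to at least B - c (F(z) - f(∅)). Second differences of f lie in [-cB, 0], so lag, step length
and sampling error together cost at most εB with ε = (c k d + c k/2 + 1) k/T. Hence a(t) = F(z(t)) -
f(∅) satisfies a(t+1) ≥ (1 - c/T) a(t) + (1 - ε) B/T, and iterating yields the factor (1 -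
e^{-c})/c. The required loss has 2 c k d in place of c k d, so it is weaker.

For the probability, put q = e^{-K_i/(8T²)}. Hoeffding's inequality with relative error 1/(2T) gives
failure probability at most 2q⁴ per coordinate. The coordinates of one agent share samples and need
not be independent, so a union bound is used; the condition 2|P_i|q ≤ 1 makes 1 - 2|P_i|q⁴ at least
(1 - 2q)^{|P_i|}. Agents multiply by independence, and steps by conditioning on the history. -/

namespace DistSubmod

/-! ### Calculus of the multilinear extension -/

section Multilinear

variable {P : Type*} [DecidableEq P]

/-- The discrete derivative of a set function in the direction of the element `p`. -/
def discreteDeriv (h : Finset P → ℝ) (p : P) (R : Finset P) : ℝ :=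
  h (insert p R) - h (R.erase p)

theorem discreteDeriv_eq_marginal (h : Finset P → ℝ) (p : P) (R : Finset P) :
    discreteDeriv h p R = marginal h p (R.erase p) := by
  rw [discreteDeriv, marginal]
  congr 2
  ext q
  by_cases hq : q = p <;> simp [hq]

/-- Lets a move from x to y be made one coordinate at a time, where F is affine. -/
theorem piecewise_insert_eq_update (s : Finset P) (x y : P → ℝ) {p : P} (hp : p ∉ s) :
    (insert p s).piecewise y x =
      Function.update (s.piecewise y x) p (s.piecewise y x p + (y p - x p)) := by
  rw [Finset.piecewise_insert, Finset.piecewise_eq_of_notMem _ _ _ hp, add_sub_cancel]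

theorem piecewise_mem_unitInterval (s : Finset P) {x y : P → ℝ}
    (hx : ∀ p, x p ∈ Set.Icc (0 : ℝ) 1) (hy : ∀ p, y p ∈ Set.Icc (0 : ℝ) 1) (p : P) :
    s.piecewise y x p ∈ Set.Icc (0 : ℝ) 1 := by
  by_cases hp : p ∈ s
  · simpa [hp] using hy p
  · simpa [hp] using hx p

variable [Fintype P]

theorem setProb_eq_prod (x : P → ℝ) (R : Finset P) :
    setProb x R = ∏ p, if p ∈ R then x p else 1 - x p := by
  rw [setProb, Finset.prod_ite]
  congr 1
  · congr 1; ext; simp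
  · congr 1; ext; simp

theorem setProb_nonneg {x : P → ℝ} (hx : ∀ p, x p ∈ Set.Icc (0 : ℝ) 1) (R : Finset P) :
    0 ≤ setProb x R :=
  mul_nonneg (Finset.prod_nonneg fun p _ => (hx p).1)
    (Finset.prod_nonneg fun p _ => sub_nonneg.2 (hx p).2)

theorem sum_setProb (x : P → ℝ) : ∑ R, setProb x R = 1 := by
  have h := Finset.prod_add (fun p => x p) (fun p => 1 - x p) Finset.univ
  simp only [add_sub_cancel, Finset.prod_const_one, Finset.powerset_univ] at h
  rw [h]
  rfl

theorem multilinearExt_const (a : ℝ) (x : P → ℝ) : multilinearExt (fun _ => a) x = a := by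
  rw [multilinearExt, ← Finset.mul_sum, sum_setProb, mul_one]

theorem multilinearExt_mono {g h : Finset P → ℝ} (hgh : ∀ R, g R ≤ h R) {x : P → ℝ}
    (hx : ∀ p, x p ∈ Set.Icc (0 : ℝ) 1) : multilinearExt g x ≤ multilinearExt h x :=
  Finset.sum_le_sum fun R _ => mul_le_mul_of_nonneg_right (hgh R) (setProb_nonneg hx R)

theorem multilinearExt_neg (h : Finset P → ℝ) (x : P → ℝ) :
    multilinearExt (fun R => -h R) x = -multilinearExt h x := by
  simp [multilinearExt]

theorem multilinearExt_sum {ι : Type*} (s : Finset ι) (h : ι → Finset P → ℝ) (x : P → ℝ) :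
    multilinearExt (fun R => ∑ i ∈ s, h i R) x = ∑ i ∈ s, multilinearExt (h i) x := by
  simp only [multilinearExt, Finset.sum_mul]
  rw [Finset.sum_comm]

theorem multilinearExt_const_sub_mul (a b : ℝ) (h : Finset P → ℝ) (x : P → ℝ) :
    multilinearExt (fun R => a - b * h R) x = a - b * multilinearExt h x := by
  simp only [multilinearExt, sub_mul, Finset.sum_sub_distrib, mul_assoc, ← Finset.mul_sum,
    sum_setProb, mul_one]

theorem multilinearExt_zero_vector (h : Finset P → ℝ) : multilinearExt h 0 = h ∅ := by
  rw [multilinearExt, Finset.sum_eq_single ∅]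
  · simp [setProb]
  · intro R _ hR
    obtain ⟨p, hp⟩ := Finset.nonempty_iff_ne_empty.2 hR
    rw [setProb, Finset.prod_eq_zero hp (by simp)]
    simp
  · simp

/-- Conditions on whether p belongs to the random set; the remaining product does not involve `x p`.
-/
theorem multilinearExt_split (h : Finset P → ℝ) (x : P → ℝ) (p : P) :
    multilinearExt h x = ∑ t ∈ (Finset.univ.erase p).powerset,
      (h t * (1 - x p) + h (insert p t) * x p) *
        ∏ q ∈ Finset.univ.erase p, if q ∈ t then x q else 1 - x q := by
  have hu : (Finset.univ : Finset (Finset P)) = (insert p (Finset.univ.erase p)).powerset := by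
    rw [Finset.insert_erase (Finset.mem_univ p), Finset.powerset_univ]
  rw [multilinearExt, hu, Finset.sum_powerset_insert (Finset.notMem_erase p _),
    ← Finset.sum_add_distrib]
  refine Finset.sum_congr rfl fun t ht => ?_
  have hpt : p ∉ t := fun hp => by simpa using Finset.mem_powerset.1 ht hp
  rw [setProb_eq_prod, setProb_eq_prod, ← Finset.mul_prod_erase _ _ (Finset.mem_univ p),
    ← Finset.mul_prod_erase _ _ (Finset.mem_univ p)]
  have hr : (∏ q ∈ Finset.univ.erase p, if q ∈ insert p t then x q else 1 - x q)
      = ∏ q ∈ Finset.univ.erase p, if q ∈ t then x q else 1 - x q := by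
    refine Finset.prod_congr rfl fun q hq => ?_
    have hqp : q ≠ p := Finset.ne_of_mem_erase hq
    simp [hqp]
  rw [hr]
  simp only [hpt, if_false, Finset.mem_insert_self, if_true]
  ring

/-- The multilinear extension is affine in each coordinate, with slope the extension of the
discrete derivative. -/
theorem multilinearExt_update (h : Finset P → ℝ) (x : P → ℝ) (p : P) (δ : ℝ) :
    multilinearExt h (Function.update x p (x p + δ)) =
      multilinearExt h x + δ * multilinearExt (discreteDeriv h p) x := by
  rw [multilinearExt_split h _ p, multilinearExt_split h x p, multilinearExt_split _ x p,
    Finset.mul_sum, ← Finset.sum_add_distrib]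
  refine Finset.sum_congr rfl fun t ht => ?_
  have hpt : p ∉ t := fun hp => by simpa using Finset.mem_powerset.1 ht hp
  have hr : (∏ q ∈ Finset.univ.erase p,
      if q ∈ t then Function.update x p (x p + δ) q else 1 - Function.update x p (x p + δ) q)
      = ∏ q ∈ Finset.univ.erase p, if q ∈ t then x q else 1 - x q := by
    refine Finset.prod_congr rfl fun q hq => ?_
    rw [Function.update_of_ne (Finset.ne_of_mem_erase hq)]
  rw [hr]
  simp only [Function.update_self, discreteDeriv, Finset.insert_idem,
    Finset.erase_insert hpt, Finset.erase_eq_of_notMem hpt]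
  ring

theorem multilinearExt_piecewise_ge {h : Finset P → ℝ} {L : ℝ}
    (hL : ∀ q R, -L ≤ discreteDeriv h q R) {x y : P → ℝ} (hxy : ∀ p, x p ≤ y p)
    (hx : ∀ p, x p ∈ Set.Icc (0 : ℝ) 1) (hy : ∀ p, y p ∈ Set.Icc (0 : ℝ) 1) (s : Finset P) :
    multilinearExt h x - L * ∑ q ∈ s, (y q - x q) ≤ multilinearExt h (s.piecewise y x) := by
  induction s using Finset.induction_on with
  | empty => simp
  | insert p s hp ih =>
    rw [piecewise_insert_eq_update s x y hp, multilinearExt_update, Finset.sum_insert hp]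
    have h1 : -L ≤ multilinearExt (discreteDeriv h p) (s.piecewise y x) := by
      simpa [multilinearExt_const] using
        multilinearExt_mono (hL p) (piecewise_mem_unitInterval s hx hy)
    nlinarith [mul_le_mul_of_nonneg_left h1 (sub_nonneg.2 (hxy p))]

theorem multilinearExt_ge_sub {h : Finset P → ℝ} {L : ℝ}
    (hL : ∀ q R, -L ≤ discreteDeriv h q R) {x y : P → ℝ} (hxy : ∀ p, x p ≤ y p)
    (hx : ∀ p, x p ∈ Set.Icc (0 : ℝ) 1) (hy : ∀ p, y p ∈ Set.Icc (0 : ℝ) 1) :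
    multilinearExt h x - L * ∑ q, (y q - x q) ≤ multilinearExt h y := by
  simpa using multilinearExt_piecewise_ge hL hxy hx hy Finset.univ

theorem multilinearExt_antitone {h : Finset P → ℝ} (hh : ∀ q R, discreteDeriv h q R ≤ 0)
    {x y : P → ℝ} (hxy : ∀ p, x p ≤ y p)
    (hx : ∀ p, x p ∈ Set.Icc (0 : ℝ) 1) (hy : ∀ p, y p ∈ Set.Icc (0 : ℝ) 1) :
    multilinearExt h y ≤ multilinearExt h x := by
  -- The first-order bound applied to -h with L = 0.
  have h1 : ∀ q R, -(0 : ℝ) ≤ discreteDeriv (fun S => -h S) q R := fun q R => by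
    have := hh q R
    simp only [discreteDeriv] at this ⊢
    linarith
  have h2 := multilinearExt_ge_sub h1 hxy hx hy
  rw [multilinearExt_neg, multilinearExt_neg] at h2
  linarith

theorem multilinearExt_piecewise_ge_second_order {h : Finset P → ℝ} {L : ℝ}
    (hL : ∀ p q R, -L ≤ discreteDeriv (discreteDeriv h p) q R) (hL0 : 0 ≤ L)
    {x y : P → ℝ} (hxy : ∀ p, x p ≤ y p)
    (hx : ∀ p, x p ∈ Set.Icc (0 : ℝ) 1) (hy : ∀ p, y p ∈ Set.Icc (0 : ℝ) 1) (s : Finset P) :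
    multilinearExt h x + ∑ p ∈ s, (y p - x p) * multilinearExt (discreteDeriv h p) x
      - L / 2 * (∑ p ∈ s, (y p - x p)) ^ 2 ≤ multilinearExt h (s.piecewise y x) := by
  induction s using Finset.induction_on with
  | empty => simp
  | insert p s hp ih =>
    rw [piecewise_insert_eq_update s x y hp, multilinearExt_update, Finset.sum_insert hp,
      Finset.sum_insert hp]
    -- The slope in direction p is taken at the hybrid point; compared with x it has dropped by at
    -- most L times the mass already moved.
    have h1 := mul_le_mul_of_nonneg_left (multilinearExt_piecewise_ge (hL p) hxy hx hy s)
      (sub_nonneg.2 (hxy p))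
    -- Expanding the square gives the cross term needed for the drop in slope; the diagonal term is
    -- slack.
    nlinarith [mul_nonneg hL0 (sq_nonneg (y p - x p))]

/-- Second-order lower bound for the multilinear extension along a nonnegative direction. -/
theorem multilinearExt_ge_second_order {h : Finset P → ℝ} {L : ℝ}
    (hL : ∀ p q R, -L ≤ discreteDeriv (discreteDeriv h p) q R) (hL0 : 0 ≤ L)
    {x y : P → ℝ} (hxy : ∀ p, x p ≤ y p)
    (hx : ∀ p, x p ∈ Set.Icc (0 : ℝ) 1) (hy : ∀ p, y p ∈ Set.Icc (0 : ℝ) 1) :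
    multilinearExt h x + ∑ p, (y p - x p) * multilinearExt (discreteDeriv h p) x
      - L / 2 * (∑ p, (y p - x p)) ^ 2 ≤ multilinearExt h y := by
  simpa using multilinearExt_piecewise_ge_second_order hL hL0 hxy hx hy Finset.univ

end Multilinear

/-! ### Curvature and bounds on marginal values -/

section Curvature

variable {P : Type*} [DecidableEq P] {f : Finset P → ℝ}

theorem marginal_nonneg (hf_mono : Monotone f) (p : P) (S : Finset P) : 0 ≤ marginal f p S :=
  sub_nonneg.2 (hf_mono (Finset.subset_insert p S))

theorem IsSubmodular.marginal_le (hf_sub : IsSubmodular f) {p : P} {S : Finset P} (hp : p ∉ S) :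
    marginal f p S ≤ marginal f p ∅ :=
  hf_sub ∅ S (Finset.empty_subset S) p hp

/-- Telescoping: the elements of U are added to S one by one, and those already in S contribute
nothing. -/
theorem le_add_sum_of_marginal_le {S : Finset P} {b : P → ℝ} (U : Finset P)
    (hb : ∀ S', S ⊆ S' → ∀ p ∈ U, p ∉ S' → marginal f p S' ≤ b p) :
    f (S ∪ U) ≤ f S + ∑ p ∈ U \ S, b p := by
  induction U using Finset.induction_on with
  | empty => simp
  | insert p U hp ih =>
    have ih' := ih fun S' hS' q hq => hb S' hS' q (Finset.mem_insert_of_mem hq)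
    by_cases hpS : p ∈ S
    · rwa [Finset.union_insert, Finset.insert_eq_of_mem (Finset.mem_union_left _ hpS),
        Finset.insert_sdiff_of_mem _ hpS]
    · rw [Finset.union_insert, Finset.insert_sdiff_of_notMem _ hpS, Finset.sum_insert (by simp [hp])]
      have := hb (S ∪ U) Finset.subset_union_left p (Finset.mem_insert_self p U) (by simp [hp, hpS])
      rw [marginal] at this
      linarith

theorem add_sum_le_of_le_marginal {S : Finset P} {b : P → ℝ} (U : Finset P)
    (hb : ∀ S', S ⊆ S' → ∀ p ∈ U, p ∉ S' → b p ≤ marginal f p S') :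
    f S + ∑ p ∈ U \ S, b p ≤ f (S ∪ U) := by
  have h := le_add_sum_of_marginal_le (f := fun R => -f R) (S := S) (b := fun p => -b p) U
    fun S' hS' p hp hpS' => by
      have := hb S' hS' p hp hpS'
      simp only [marginal] at this ⊢
      linarith
  rw [Finset.sum_neg_distrib] at h
  linarith

theorem curvature_le_one (hf_mono : Monotone f) : curvature f ≤ 1 := by
  rw [curvature, sub_le_self_iff]
  refine Real.iInf_nonneg fun a => ?_
  rw [marginalRatio]
  split_ifs
  · exact zero_le_one
  · exact div_nonneg (marginal_nonneg hf_mono _ _) (marginal_nonneg hf_mono _ _)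

variable [Fintype P]

theorem one_sub_curvature_le_marginalRatio {p : P} {S : Finset P} (hp : p ∉ S) :
    1 - curvature f ≤ marginalRatio f p S := by
  rw [curvature, sub_sub_cancel]
  exact ciInf_le (Set.finite_range _).bddBelow (⟨(p, S), hp⟩ : {a : P × Finset P // a.1 ∉ a.2})

/-- At S = ∅ the ratio is 1, so the minimum is at most 1. -/
theorem curvature_nonneg [Nonempty P] : 0 ≤ curvature f := by
  obtain ⟨p⟩ := ‹Nonempty P›
  have h := one_sub_curvature_le_marginalRatio (f := f) (Finset.notMem_empty p)
  rw [marginalRatio] at h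
  split_ifs at h with h0
  · linarith
  · rw [div_self h0] at h
    linarith

theorem one_sub_curvature_mul_le_marginal (hf_mono : Monotone f) {p : P} {S : Finset P}
    (hp : p ∉ S) : (1 - curvature f) * marginal f p ∅ ≤ marginal f p S := by
  have h := one_sub_curvature_le_marginalRatio (f := f) hp
  rw [marginalRatio] at h
  split_ifs at h with h0
  · rw [h0, mul_zero]
    exact marginal_nonneg hf_mono p S
  · exact (le_div_iff₀ (lt_of_le_of_ne (marginal_nonneg hf_mono p ∅) (Ne.symm h0))).1 h

theorem discreteDeriv_mem_Icc (hf_mono : Monotone f) (hf_sub : IsSubmodular f) (p : P)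
    (R : Finset P) : discreteDeriv f p R ∈
      Set.Icc ((1 - curvature f) * marginal f p ∅) (marginal f p ∅) := by
  rw [discreteDeriv_eq_marginal]
  exact ⟨one_sub_curvature_mul_le_marginal hf_mono (Finset.notMem_erase p R),
    hf_sub.marginal_le (Finset.notMem_erase p R)⟩

/-- Both values of the first derivative lie in an interval of length c Δ_f(p | ∅). -/
theorem neg_le_discreteDeriv_discreteDeriv (hf_mono : Monotone f) (hf_sub : IsSubmodular f)
    (p q : P) (R : Finset P) :
    -(curvature f * marginal f p ∅) ≤ discreteDeriv (discreteDeriv f p) q R := by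
  have h1 := (discreteDeriv_mem_Icc hf_mono hf_sub p (insert q R)).1
  have h2 := (discreteDeriv_mem_Icc hf_mono hf_sub p (R.erase q)).2
  rw [discreteDeriv.eq_def (discreteDeriv f p)]
  linarith

omit [Fintype P] in
theorem discreteDeriv_discreteDeriv_nonpos (hf_sub : IsSubmodular f)
    (p q : P) (R : Finset P) : discreteDeriv (discreteDeriv f p) q R ≤ 0 := by
  rw [discreteDeriv, sub_nonpos, discreteDeriv_eq_marginal, discreteDeriv_eq_marginal]
  refine hf_sub _ _ (Finset.erase_subset_erase p ?_) p (Finset.notMem_erase _ _)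
  exact (Finset.erase_subset q R).trans (Finset.subset_insert q R)

/-- The derivatives in the directions of a set `S` dominate the gap of `R` to `S`, with the value
of `R` discounted by the curvature. -/
theorem gap_le_sum_discreteDeriv (hf_mono : Monotone f) (hf_sub : IsSubmodular f)
    (S R : Finset P) :
    (f S - f ∅) - curvature f * (f R - f ∅) ≤ ∑ p ∈ S, discreteDeriv f p R := by
  have h1 : f (R ∪ S) ≤ f R + ∑ p ∈ S \ R, discreteDeriv f p R := by
    have h := le_add_sum_of_marginal_le (f := f) (S := R) (b := fun p => marginal f p R) S
      fun S' hS' p _ hp => hf_sub R S' hS' p hp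
    refine h.trans_eq (congrArg _ (Finset.sum_congr rfl fun p hp => ?_))
    rw [discreteDeriv_eq_marginal, Finset.erase_eq_of_notMem (Finset.mem_sdiff.1 hp).2]
  -- Curvature gives more than monotonicity here: adding R to S retains a fraction 1 - c of the
  -- singleton values, which by `h3` and `h4` discounts f(R) to c f(R).
  have h2 : f S + ∑ p ∈ R \ S, (1 - curvature f) * marginal f p ∅ ≤ f (S ∪ R) :=
    add_sum_le_of_le_marginal R fun S' _ p _ hp => one_sub_curvature_mul_le_marginal hf_mono hp
  have h3 : f R ≤ f ∅ + ∑ p ∈ R, marginal f p ∅ := by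
    have h := le_add_sum_of_marginal_le (f := f) (S := ∅) (b := fun p => marginal f p ∅) R
      fun S' _ p _ hp => hf_sub.marginal_le hp
    simpa using h
  have h4 : ∑ p ∈ S ∩ R, (1 - curvature f) * marginal f p ∅ ≤ ∑ p ∈ S ∩ R, discreteDeriv f p R :=
    Finset.sum_le_sum fun p _ => (discreteDeriv_mem_Icc hf_mono hf_sub p R).1
  have h5 := Finset.sum_inter_add_sum_sdiff S R fun p => discreteDeriv f p R
  have h6 := Finset.sum_inter_add_sum_sdiff R S fun p => (1 - curvature f) * marginal f p ∅
  rw [Finset.union_comm] at h2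
  rw [Finset.inter_comm] at h6
  rw [← Finset.mul_sum R] at h6
  have h7 := mul_le_mul_of_nonneg_left h3 (sub_nonneg.2 (curvature_le_one hf_mono))
  linarith

theorem gap_le_sum_multilinearExt (hf_mono : Monotone f) (hf_sub : IsSubmodular f)
    (S : Finset P) {x : P → ℝ} (hx : ∀ p, x p ∈ Set.Icc (0 : ℝ) 1) :
    (f S - f ∅) - curvature f * (multilinearExt f x - f ∅) ≤
      ∑ p ∈ S, multilinearExt (discreteDeriv f p) x := by
  have h := multilinearExt_mono
    (g := fun R => ((f S - f ∅) + curvature f * f ∅) - curvature f * f R)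
    (h := fun R => ∑ p ∈ S, discreteDeriv f p R)
    (fun R => by linarith [gap_le_sum_discreteDeriv hf_mono hf_sub S R]) hx
  rw [multilinearExt_const_sub_mul, multilinearExt_sum] at h
  linarith

end Curvature

/-! ### Partition constraint and the gain of one ascent step -/

section Feasible

variable {A P : Type*} [Fintype A] [DecidableEq A] [Fintype P] [DecidableEq P]
  {f : Finset P → ℝ} {owner : P → A} {κ : A → ℕ}

omit [Fintype A] in
-- Singletons are feasible because every `κ i` is at least 1, so B bounds all marginal values.
theorem marginal_empty_le_of_isOptimizer (hκ : ∀ i, 1 ≤ κ i) {S : Finset P}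
    (hS : IsOptimizer owner κ f S) (p : P) : marginal f p ∅ ≤ f S - f ∅ := by
  refine sub_le_sub_right (hS.2 _ fun i => ?_) _
  exact ((Finset.card_le_card Finset.inter_subset_left).trans (by simp)).trans (hκ i)

theorem card_le_of_mem_feasible {S : Finset P} (hS : S ∈ feasible owner κ) :
    (S.card : ℝ) ≤ ∑ i, (κ i : ℝ) := by
  have h := Finset.card_eq_sum_card_fiberwise (s := S) (t := Finset.univ) (f := owner)
    fun p _ => by simp
  rw [h]
  push_cast
  refine Finset.sum_le_sum fun i _ => ?_
  have h1 : {p ∈ S | owner p = i} = S ∩ strategySet owner i := by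
    ext; simp [strategySet]
  rw [h1]
  exact_mod_cast hS i

omit [Fintype A] in
-- The competitor against which each agent's local maximizer is compared.
theorem indicator_mem_localPolytope {S : Finset P} (hS : S ∈ feasible owner κ) (i : A) :
    (fun p => if p ∈ S ∧ owner p = i then (1 : ℝ) else 0) ∈ localPolytope owner κ i := by
  refine ⟨fun p => ?_, ?_, fun p hp => by simp [hp]⟩
  · by_cases h : p ∈ S ∧ owner p = i <;> simp [h]
  · have h1 : (S ∩ strategySet owner i) = ({p | p ∈ S ∧ owner p = i} : Finset P) := by
      ext; simp [strategySet]
    have h2 := hS i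
    rw [h1] at h2
    rw [Finset.sum_boole]
    exact_mod_cast h2

omit [DecidableEq A] [DecidableEq P] in
-- Each agent's direction is supported on its own strategies, so the local linear problems add up to
-- a global one.
theorem sum_owner_eq {w : A → P → ℝ} (hw : ∀ i p, owner p ≠ i → w i p = 0) (g : A → P → ℝ) :
    ∑ p, w (owner p) p * g (owner p) p = ∑ i, ∑ p, w i p * g i p := by
  rw [Finset.sum_comm]
  refine Finset.sum_congr rfl fun p _ => ?_
  rw [Finset.sum_eq_single (owner p)]
  · intro i _ hi
    rw [hw i p hi.symm, zero_mul]
  · simp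

omit [DecidableEq A] [DecidableEq P] in
theorem sum_owner_le {w : A → P → ℝ} (hw : ∀ i, w i ∈ localPolytope owner κ i) :
    ∑ p, w (owner p) p ≤ ∑ i, (κ i : ℝ) := by
  have h := sum_owner_eq (fun i p => (hw i).2.2 p) fun _ _ => (1 : ℝ)
  simp only [mul_one] at h
  rw [h]
  exact Finset.sum_le_sum fun i _ => (hw i).2.1

/-- The first-order gain along locally optimal directions for inexact gradients that are evaluated
at lagging points `y i ≤ z`. -/
theorem sum_direction_mul_gradient_ge (hf_mono : Monotone f) (hf_sub : IsSubmodular f)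
    (hκ : ∀ i, 1 ≤ κ i) {S : Finset P} (hS : IsOptimizer owner κ f S)
    {z : P → ℝ} {y g w : A → P → ℝ} {η lag : ℝ} (hη : 0 ≤ η)
    (hz : ∀ p, z p ∈ Set.Icc (0 : ℝ) 1) (hy : ∀ i p, y i p ∈ Set.Icc (0 : ℝ) 1)
    (hyz : ∀ i p, y i p ≤ z p) (hlag0 : 0 ≤ lag) (hlag : ∀ i, ∑ p, (z p - y i p) ≤ lag)
    (hg : ∀ p, |g (owner p) p - multilinearExt (discreteDeriv f p) (y (owner p))|
      ≤ η * marginal f p ∅)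
    (hw : ∀ i, w i ∈ localPolytope owner κ i)
    (hmax : ∀ i, ∀ u ∈ localPolytope owner κ i, ∑ p, u p * g i p ≤ ∑ p, w i p * g i p)
    (hc0 : 0 ≤ curvature f) :
    (f S - f ∅) - curvature f * (multilinearExt f z - f ∅)
        - (∑ i, (κ i : ℝ)) * (curvature f * lag + 2 * η) * (f S - f ∅)
      ≤ ∑ p, w (owner p) p * multilinearExt (discreteDeriv f p) z := by
  set B := f S - f ∅ with hB
  have ha : ∀ p, marginal f p ∅ ≤ B := marginal_empty_le_of_isOptimizer hκ hS
  have hB0 : 0 ≤ B := sub_nonneg.2 (hf_mono (Finset.empty_subset S))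
  have hg' : ∀ p, |g (owner p) p - multilinearExt (discreteDeriv f p) (y (owner p))| ≤ η * B :=
    fun p => (hg p).trans (mul_le_mul_of_nonneg_left (ha p) hη)
  -- Passing from the lagging point up to z can lower the derivative, so the lag is paid for here.
  have hlow : ∀ p, g (owner p) p - (η * B + curvature f * B * lag)
      ≤ multilinearExt (discreteDeriv f p) z := fun p => by
    have h1 := multilinearExt_ge_sub (neg_le_discreteDeriv_discreteDeriv hf_mono hf_sub p)
      (hyz (owner p)) (hy (owner p)) hz
    have h2 : curvature f * marginal f p ∅ * ∑ q, (z q - y (owner p) q)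
        ≤ curvature f * B * lag :=
      mul_le_mul (mul_le_mul_of_nonneg_left (ha p) hc0) (hlag _)
        (Finset.sum_nonneg fun q _ => sub_nonneg.2 (hyz _ q)) (mul_nonneg hc0 hB0)
    have h3 := (abs_le.1 (hg' p)).2
    linarith
  -- The derivative at the lagging point is at least that at z, so this direction costs only
  -- sampling error.
  have hup : ∀ p, multilinearExt (discreteDeriv f p) z - η * B ≤ g (owner p) p := fun p => by
    have h1 := multilinearExt_antitone (discreteDeriv_discreteDeriv_nonpos hf_sub p)
      (hyz (owner p)) (hy (owner p)) hz
    have h3 := (abs_le.1 (hg' p)).1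
    linarith
  have s1 : ∑ p, w (owner p) p * g (owner p) p
      - (∑ p, w (owner p) p) * (η * B + curvature f * B * lag)
      ≤ ∑ p, w (owner p) p * multilinearExt (discreteDeriv f p) z := by
    rw [Finset.sum_mul, ← Finset.sum_sub_distrib]
    refine Finset.sum_le_sum fun p _ => ?_
    have := mul_le_mul_of_nonneg_left (hlow p) ((hw (owner p)).1 p).1
    linarith
  have s2 : ∑ p ∈ S, g (owner p) p ≤ ∑ p, w (owner p) p * g (owner p) p := by
    have h1 := sum_owner_eq (fun i p => (hw i).2.2 p) g
    have h2 := sum_owner_eq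
      (fun i p => (indicator_mem_localPolytope hS.1 i).2.2 p) g
    rw [h1]
    calc ∑ p ∈ S, g (owner p) p
        = ∑ p, (if p ∈ S ∧ owner p = owner p then (1 : ℝ) else 0) * g (owner p) p := by simp
      _ = ∑ i, ∑ p, (if p ∈ S ∧ owner p = i then (1 : ℝ) else 0) * g i p := h2
      _ ≤ _ := Finset.sum_le_sum fun i _ => hmax i _ (indicator_mem_localPolytope hS.1 i)
  have s3 : ∑ p ∈ S, multilinearExt (discreteDeriv f p) z - S.card * (η * B)
      ≤ ∑ p ∈ S, g (owner p) p := by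
    rw [← nsmul_eq_mul, ← Finset.sum_const, ← Finset.sum_sub_distrib]
    exact Finset.sum_le_sum fun p _ => hup p
  have s4 := gap_le_sum_multilinearExt hf_mono hf_sub S hz
  have s5 := mul_le_mul_of_nonneg_right (card_le_of_mem_feasible hS.1) (mul_nonneg hη hB0)
  have s6 := mul_le_mul_of_nonneg_right (sum_owner_le hw)
    (add_nonneg (mul_nonneg hη hB0) (mul_nonneg (mul_nonneg hc0 hB0) hlag0))
  linarith

/-- One ascent step of length `δ`. -/
theorem multilinearExt_step_ge (hf_mono : Monotone f) (hf_sub : IsSubmodular f)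
    (hκ : ∀ i, 1 ≤ κ i) {S : Finset P} (hS : IsOptimizer owner κ f S)
    {z z' : P → ℝ} {y g w : A → P → ℝ} {η lag δ : ℝ} (hη : 0 ≤ η) (hδ : 0 ≤ δ)
    (hz : ∀ p, z p ∈ Set.Icc (0 : ℝ) 1) (hy : ∀ i p, y i p ∈ Set.Icc (0 : ℝ) 1)
    (hz' : ∀ p, z' p ∈ Set.Icc (0 : ℝ) 1) (hzz' : ∀ p, z' p = z p + δ * w (owner p) p)
    (hyz : ∀ i p, y i p ≤ z p) (hlag0 : 0 ≤ lag) (hlag : ∀ i, ∑ p, (z p - y i p) ≤ lag)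
    (hg : ∀ p, |g (owner p) p - multilinearExt (discreteDeriv f p) (y (owner p))|
      ≤ η * marginal f p ∅)
    (hw : ∀ i, w i ∈ localPolytope owner κ i)
    (hmax : ∀ i, ∀ u ∈ localPolytope owner κ i, ∑ p, u p * g i p ≤ ∑ p, w i p * g i p)
    (hc0 : 0 ≤ curvature f) :
    (1 - curvature f * δ) * (multilinearExt f z - f ∅) + δ *
        ((1 - ((∑ i, (κ i : ℝ)) * (curvature f * lag + 2 * η)
          + curvature f * δ / 2 * (∑ i, (κ i : ℝ)) ^ 2)) * (f S - f ∅))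
      ≤ multilinearExt f z' - f ∅ := by
  have hB0 : 0 ≤ f S - f ∅ := sub_nonneg.2 (hf_mono (Finset.empty_subset S))
  have hL : ∀ p q R, -(curvature f * (f S - f ∅)) ≤ discreteDeriv (discreteDeriv f p) q R :=
    fun p q R => (neg_le_neg (mul_le_mul_of_nonneg_left
      (marginal_empty_le_of_isOptimizer hκ hS p) hc0)).trans
        (neg_le_discreteDeriv_discreteDeriv hf_mono hf_sub p q R)
  have hle : ∀ p, z p ≤ z' p := fun p => by
    rw [hzz' p]
    linarith [mul_nonneg hδ ((hw (owner p)).1 p).1]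
  have h1 := multilinearExt_ge_second_order hL (mul_nonneg hc0 hB0) hle hz hz'
  have h2 := sum_direction_mul_gradient_ge hf_mono hf_sub hκ hS hη hz hy hyz hlag0 hlag hg hw
    hmax hc0
  simp only [hzz', add_sub_cancel_left, mul_assoc, ← Finset.mul_sum] at h1
  have h3 := mul_le_mul_of_nonneg_left h2 hδ
  have h4 : (∑ p, w (owner p) p) ^ 2 ≤ (∑ i, (κ i : ℝ)) ^ 2 :=
    pow_le_pow_left₀ (Finset.sum_nonneg fun p _ => ((hw (owner p)).1 p).1) (sum_owner_le hw) 2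
  have h5 := mul_le_mul_of_nonneg_left h4
    (mul_nonneg (mul_nonneg hc0 hB0) (mul_nonneg hδ hδ))
  have h6 : multilinearExt f z' = multilinearExt f fun p => z p + δ * w (owner p) p := by
    congr 1
    exact funext hzz'
  rw [h6]
  nlinarith

end Feasible

/-! ### Propagation and maximum consensus -/

section Trajectory

variable {A P : Type*} [Fintype A] [Fintype P] {G : SimpleGraph A} {owner : P → A} {κ : A → ℕ}
  {T : ℕ} {X V : ℕ → A → P → ℝ}

omit [Fintype P] in
theorem le_neighborMax (y : A → P → ℝ) {i j : A} (h : j = i ∨ G.Adj i j) (p : P) :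
    y j p ≤ neighborMax G y i p :=
  le_ciSup (f := fun j : {j : A // j = i ∨ G.Adj i j} => y j p)
    (Set.finite_range _).bddAbove ⟨j, h⟩

omit [Fintype A] [Fintype P] in
theorem neighborMax_le {y : A → P → ℝ} {p : P} {b : ℝ} (h : ∀ j, y j p ≤ b) (i : A) :
    neighborMax G y i p ≤ b :=
  haveI : Nonempty {j : A // j = i ∨ G.Adj i j} := ⟨⟨i, Or.inl rfl⟩⟩
  ciSup_le fun j => h j

/-- A deterministic trajectory of the propagation and maximum-consensus iteration. -/
structure IsTrajectory (G : SimpleGraph A) (owner : P → A) (κ : A → ℕ) (T : ℕ)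
    (X V : ℕ → A → P → ℝ) : Prop where
  init : ∀ i, X 0 i = 0
  direction_mem : ∀ t < T, ∀ i, V t i ∈ localPolytope owner κ i
  update : ∀ t < T, ∀ i,
    X (t + 1) i = neighborMax G (fun j p => X t j p + (1 / (T : ℝ)) * V t j p) i

namespace IsTrajectory

theorem le_succ_of_adj (h : IsTrajectory G owner κ T X V) {t : ℕ} (ht : t < T) {i j : A}
    (hij : j = i ∨ G.Adj i j) (p : P) : X t j p ≤ X (t + 1) i p := by
  rw [h.update t ht i]
  refine le_trans ?_ (le_neighborMax _ hij p)
  have := mul_nonneg (one_div_nonneg.2 (Nat.cast_nonneg (α := ℝ) T))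
    ((h.direction_mem t ht j).1 p).1
  linarith

theorem mono (h : IsTrajectory G owner κ T X V) {s t : ℕ} (hst : s ≤ t) (ht : t ≤ T) (i : A)
    (p : P) : X s i p ≤ X t i p := by
  induction t, hst using Nat.le_induction with
  | base => rfl
  | succ t _ ih => exact (ih (by omega)).trans (h.le_succ_of_adj (by omega) (Or.inl rfl) p)

theorem nonneg (h : IsTrajectory G owner κ T X V) {t : ℕ} (ht : t ≤ T) (i : A) (p : P) :
    0 ≤ X t i p := by
  have := h.mono (Nat.zero_le t) ht i p
  rwa [h.init i] at this

omit [Fintype A] in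
theorem succ_le_owner (h : IsTrajectory G owner κ T X V) {t : ℕ} (ht : t < T) {p : P}
    (hle : ∀ j, X t j p ≤ X t (owner p) p) (i : A) :
    X (t + 1) i p ≤ X t (owner p) p + 1 / (T : ℝ) * V t (owner p) p := by
  rw [h.update t ht i]
  refine neighborMax_le (y := fun j p => X t j p + (1 / (T : ℝ)) * V t j p)
    (fun j => add_le_add (hle j)
    (mul_le_mul_of_nonneg_left ?_ (one_div_nonneg.2 (Nat.cast_nonneg T)))) i
  -- A non-owner's direction vanishes at p, so no other agent can overtake the owner.
  by_cases hj : owner p = j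
  · rw [hj]
  · rw [(h.direction_mem t ht j).2.2 p hj]
    exact ((h.direction_mem t ht _).1 p).1

theorem le_owner (h : IsTrajectory G owner κ T X V) {t : ℕ} (ht : t ≤ T) (i : A) (p : P) :
    X t i p ≤ X t (owner p) p := by
  induction t generalizing i with
  | zero => rw [h.init, h.init]
  | succ t ih =>
    refine (h.succ_le_owner ht (ih (by omega)) i).trans ?_
    rw [h.update t ht (owner p)]
    exact le_neighborMax (fun j p => X t j p + (1 / (T : ℝ)) * V t j p) (Or.inl rfl) p

theorem owner_succ (h : IsTrajectory G owner κ T X V) {t : ℕ} (ht : t < T) (p : P) :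
    X (t + 1) (owner p) p = X t (owner p) p + 1 / (T : ℝ) * V t (owner p) p := by
  refine le_antisymm (h.succ_le_owner ht (fun j => h.le_owner ht.le j p) _) ?_
  rw [h.update t ht (owner p)]
  exact le_neighborMax (fun j p => X t j p + (1 / (T : ℝ)) * V t j p) (Or.inl rfl) p

theorem owner_le_div (h : IsTrajectory G owner κ T X V) {t : ℕ} (ht : t ≤ T) (p : P) :
    X t (owner p) p ≤ t / T := by
  induction t with
  | zero => simp [h.init]
  | succ t ih =>
    rw [h.owner_succ ht p]
    have h1 := mul_le_mul_of_nonneg_left ((h.direction_mem t ht (owner p)).1 p).2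
      (one_div_nonneg.2 (Nat.cast_nonneg (α := ℝ) T))
    have h2 := ih (by omega)
    push_cast
    rw [add_div]
    linarith

theorem mem_Icc (h : IsTrajectory G owner κ T X V) {t : ℕ} (ht : t ≤ T) (i : A) (p : P) :
    X t i p ∈ Set.Icc (0 : ℝ) 1 :=
  ⟨h.nonneg ht i p, (h.le_owner ht i p).trans ((h.owner_le_div ht p).trans
    (div_le_one_of_le₀ (by exact_mod_cast ht) (Nat.cast_nonneg T)))⟩

theorem le_of_walk (h : IsTrajectory G owner κ T X V) {i j : A} (w : G.Walk j i) {t : ℕ}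
    (ht : t + w.length ≤ T) (p : P) : X t j p ≤ X (t + w.length) i p := by
  induction w generalizing t with
  | nil => rfl
  | cons hadj w ih =>
    rw [SimpleGraph.Walk.length_cons] at ht ⊢
    have h1 := h.le_succ_of_adj (t := t) (by omega) (Or.inr hadj.symm) p
    have h2 := ih (t := t + 1) (by omega)
    rw [show t + (w.length + 1) = t + 1 + w.length by omega]
    exact h1.trans h2

theorem le_add_diam (h : IsTrajectory G owner κ T X V) (hG : G.Connected) {t : ℕ}
    (ht : t + G.diam ≤ T) (i j : A) (p : P) : X t j p ≤ X (t + G.diam) i p := by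
  have := hG.nonempty
  obtain ⟨w, hw⟩ := hG.exists_walk_length_eq_dist j i
  have hd : w.length ≤ G.diam := by
    rw [hw]
    exact SimpleGraph.dist_le_diam (SimpleGraph.connected_iff_ediam_ne_top.1 hG)
  exact (h.le_of_walk w (by omega) p).trans (h.mono (by omega) ht i p)

theorem sum_owner_sub_le (h : IsTrajectory G owner κ T X V) {s t : ℕ}
    (hst : s ≤ t) (ht : t ≤ T) : ∑ p, (X t (owner p) p - X s (owner p) p) ≤
      ((t : ℝ) - s) * ((∑ i, (κ i : ℝ)) / T) := by
  induction t, hst using Nat.le_induction with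
  | base => simp
  | succ t _ ih =>
    have h1 := ih (by omega)
    have h2 := mul_le_mul_of_nonneg_left (sum_owner_le (h.direction_mem t ht))
      (one_div_nonneg.2 (Nat.cast_nonneg (α := ℝ) T))
    rw [Finset.mul_sum, one_div_mul_eq_div] at h2
    have h3 : ∑ p, (X (t + 1) (owner p) p - X s (owner p) p) =
        ∑ p, (X t (owner p) p - X s (owner p) p) + ∑ p, 1 / (T : ℝ) * V t (owner p) p := by
      rw [← Finset.sum_add_distrib]
      refine Finset.sum_congr rfl fun p _ => ?_
      rw [h.owner_succ ht p]
      ring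
    rw [h3]
    push_cast
    linarith

/-- The total disagreement of an agent with the leading values is bounded by the diameter. -/
theorem sum_lag_le (h : IsTrajectory G owner κ T X V) (hG : G.Connected) {t : ℕ}
    (ht : t ≤ T) (i : A) :
    ∑ p, (X t (owner p) p - X t i p) ≤ G.diam * ((∑ i, (κ i : ℝ)) / T) := by
  have hs : ∑ p, (X t (owner p) p - X t i p) ≤
      ∑ p, (X t (owner p) p - X (t - G.diam) (owner p) p) := by
    refine Finset.sum_le_sum fun p _ => sub_le_sub_left ?_ _
    -- After d steps the owner's old value has reached everyone. For t ≤ d the truncated difference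
    -- is time 0, where all values vanish.
    rcases le_total G.diam t with hd | hd
    · have := h.le_add_diam hG (t := t - G.diam) (by omega) i (owner p) p
      rwa [Nat.sub_add_cancel hd] at this
    · rw [Nat.sub_eq_zero_of_le hd, h.init]
      exact h.nonneg ht i p
  refine hs.trans ((h.sum_owner_sub_le (Nat.sub_le _ _) ht).trans ?_)
  refine mul_le_mul_of_nonneg_right ?_
    (div_nonneg (Finset.sum_nonneg fun i _ => Nat.cast_nonneg _) (Nat.cast_nonneg T))
  have : (t : ℝ) ≤ (t - G.diam : ℕ) + (G.diam : ℝ) := by exact_mod_cast (by omega)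
  linarith

theorem agentMax_eq (h : IsTrajectory G owner κ T X V) {t : ℕ} (ht : t ≤ T) :
    agentMax (X t) = fun p => X t (owner p) p := by
  funext p
  have : Nonempty A := ⟨owner p⟩
  exact le_antisymm (ciSup_le fun i => h.le_owner ht i p)
    (le_ciSup (f := fun i => X t i p) (Set.finite_range _).bddAbove (owner p))

end IsTrajectory

end Trajectory

/-! ### The scalar recursion -/

section Recursion

theorem curvatureFactor_nonneg {c : ℝ} (hc : 0 ≤ c) : 0 ≤ curvatureFactor c := by
  rw [curvatureFactor]
  split_ifs
  · exact zero_le_one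
  · exact mul_nonneg (one_div_nonneg.2 hc)
      (sub_nonneg.2 (Real.exp_le_one_iff.2 (neg_nonpos.2 hc)))

theorem curvatureFactor_le_one {c : ℝ} (hc : 0 ≤ c) : curvatureFactor c ≤ 1 := by
  rw [curvatureFactor]
  split_ifs with h0
  · exact le_rfl
  · rw [one_div_mul_eq_div, div_le_one (lt_of_le_of_ne hc (Ne.symm h0))]
    linarith [Real.add_one_le_exp (-c)]

/-- A sequence with `a (t + 1) ≥ (1 - c / T) a t + M / T` reaches the curvature factor times `M`
after `T` steps. -/
theorem curvatureFactor_mul_le_of_recursion {c M : ℝ} {T : ℕ} {a : ℕ → ℝ} (hc0 : 0 ≤ c)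
    (hc1 : c ≤ 1) (hT : 1 ≤ T) (hM : 0 ≤ M) (ha0 : 0 ≤ a 0)
    (ha : ∀ t < T, (1 - c * (1 / (T : ℝ))) * a t + 1 / (T : ℝ) * M ≤ a (t + 1)) :
    curvatureFactor c * M ≤ a T := by
  have hT1 : (1 : ℝ) ≤ T := by exact_mod_cast hT
  have hT0 : (0 : ℝ) < T := by linarith
  rw [curvatureFactor]
  split_ifs with h0
  · have h1 : ∀ t ≤ T, t * (1 / (T : ℝ) * M) ≤ a t := by
      intro t
      induction t with
      | zero => simpa using ha0
      | succ t ih =>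
        intro ht
        have h2 := ha t ht
        have h3 := ih (by omega)
        rw [h0] at h2
        push_cast
        linarith
    have h2 := h1 T le_rfl
    rwa [← mul_assoc, mul_one_div_cancel hT0.ne', one_mul] at *
  · have hcp : 0 < c := lt_of_le_of_ne hc0 (Ne.symm h0)
    have hq : 0 ≤ 1 - c * (1 / (T : ℝ)) := by
      rw [mul_one_div, sub_nonneg, div_le_one hT0]
      linarith
    have h1 : ∀ t ≤ T, (1 - (1 - c * (1 / (T : ℝ))) ^ t) * M ≤ c * a t := by
      intro t
      induction t with
      | zero => simpa using mul_nonneg hc0 ha0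
      | succ t ih =>
        intro ht
        have h2 := mul_le_mul_of_nonneg_left (ha t ht) hc0
        have h3 := mul_le_mul_of_nonneg_left (ih (by omega)) hq
        rw [pow_succ]
        linarith
    have h2 := h1 T le_rfl
    have h3 : (1 - c * (1 / (T : ℝ))) ^ T ≤ Real.exp (-c) := by
      rw [mul_one_div]
      exact Real.one_sub_div_pow_le_exp_neg (by linarith)
    have h4 := mul_le_mul_of_nonneg_right (sub_le_sub_left h3 1) hM
    rw [mul_assoc, one_div_mul_eq_div, div_le_iff₀ hcp]
    linarith

end Recursion

/-! ### Guarantee along an accurate trajectory -/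

section Deterministic

variable {A P : Type*} [Fintype A] [DecidableEq A] [Fintype P] [DecidableEq P]
  {G : SimpleGraph A} {owner : P → A} {κ : A → ℕ} {T : ℕ} {X V g : ℕ → A → P → ℝ}
  {f : Finset P → ℝ}

/-- The performance guarantee of a trajectory along which every gradient estimate is accurate. -/
theorem IsTrajectory.guarantee (h : IsTrajectory G owner κ T X V) (hG : G.Connected)
    (hκ : ∀ i, 1 ≤ κ i) (hf_nonneg : ∀ S, 0 ≤ f S) (hf_mono : Monotone f)
    (hf_sub : IsSubmodular f) (hc0 : 0 ≤ curvature f) {S : Finset P}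
    (hS : IsOptimizer owner κ f S) (hT : 1 ≤ T)
    (hg : ∀ t < T, ∀ p, |g t (owner p) p - multilinearExt (discreteDeriv f p) (X t (owner p))|
      ≤ 1 / (2 * (T : ℝ)) * marginal f p ∅)
    (hmax : ∀ t < T, ∀ i, ∀ u ∈ localPolytope owner κ i,
      ∑ p, u p * g t i p ≤ ∑ p, V t i p * g t i p) :
    curvatureFactor (curvature f) * (1 - (2 * curvature f * (∑ i, (κ i : ℝ)) * G.diam
        + curvature f * (∑ i, (κ i : ℝ)) / 2 + 1) * ((∑ i, (κ i : ℝ)) / T)) * f S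
      ≤ multilinearExt f (agentMax (X T)) := by
  rw [h.agentMax_eq le_rfl]
  set k := ∑ i, (κ i : ℝ) with hk
  set c := curvature f with hc
  have hk0 : 0 ≤ k := Finset.sum_nonneg fun i _ => Nat.cast_nonneg _
  have hT0 : (0 : ℝ) < T := by exact_mod_cast hT
  have hc1 : c ≤ 1 := curvature_le_one hf_mono
  have hB0 : 0 ≤ f S - f ∅ := sub_nonneg.2 (hf_mono (Finset.empty_subset S))
  have hd0 : (0 : ℝ) ≤ G.diam := Nat.cast_nonneg _
  set ε := (c * k * G.diam + c * k / 2 + 1) * (k / T) with hε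
  have hkT : 0 ≤ k / T := div_nonneg hk0 hT0.le
  have hε0 : 0 ≤ ε := mul_nonneg (by positivity) hkT
  have hεle : ε ≤ (2 * c * k * G.diam + c * k / 2 + 1) * (k / T) := by
    refine mul_le_mul_of_nonneg_right ?_ hkT
    linarith [mul_nonneg (mul_nonneg hc0 hk0) hd0]
  have hφ0 := curvatureFactor_nonneg hc0
  have hφ1 := curvatureFactor_le_one hc0
  have hmono : curvatureFactor c * (1 - (2 * c * k * G.diam + c * k / 2 + 1) * (k / T)) * f S
      ≤ curvatureFactor c * (1 - ε) * f S :=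
    mul_le_mul_of_nonneg_right
      (mul_le_mul_of_nonneg_left (sub_le_sub_left hεle 1) hφ0) (hf_nonneg S)
  refine hmono.trans ?_
  -- If ε ≥ 1 the claimed bound is nonpositive; otherwise (1 - ε) B is an admissible target M for
  -- the recursion.
  rcases le_total (1 - ε) 0 with hneg | hpos
  · refine le_trans (mul_nonpos_of_nonpos_of_nonneg
      (mul_nonpos_of_nonneg_of_nonpos hφ0 hneg) (hf_nonneg S)) ?_
    have := multilinearExt_mono hf_nonneg (fun p => h.mem_Icc le_rfl (owner p) p)
    rwa [multilinearExt_const] at this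
  · have hrec : ∀ t < T, (1 - c * (1 / (T : ℝ))) *
          (multilinearExt f (fun p => X t (owner p) p) - f ∅)
          + 1 / (T : ℝ) * ((1 - ε) * (f S - f ∅))
        ≤ multilinearExt f (fun p => X (t + 1) (owner p) p) - f ∅ := fun t ht => by
      have h1 := multilinearExt_step_ge hf_mono hf_sub hκ hS
        (z := fun p => X t (owner p) p) (z' := fun p => X (t + 1) (owner p) p)
        (y := X t) (g := g t) (w := V t) (η := 1 / (2 * (T : ℝ))) (δ := 1 / (T : ℝ))
        (lag := G.diam * (k / T))
        (by positivity) (by positivity) (fun p => h.mem_Icc ht.le _ p) (h.mem_Icc ht.le)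
        (fun p => h.mem_Icc ht _ p) (h.owner_succ ht) (h.le_owner ht.le) (by positivity)
        (h.sum_lag_le hG ht.le) (hg t ht) (h.direction_mem t ht) (hmax t ht) hc0
      -- The three parts of ε: lag, sampling error 1/(2T) counted twice, and curvature along the
      -- step.
      have h2 : k * (c * (G.diam * (k / T)) + 2 * (1 / (2 * (T : ℝ))))
          + c * (1 / (T : ℝ)) / 2 * k ^ 2 = ε := by
        rw [hε]
        field_simp
        ring
      rwa [h2] at h1
    have hfin := curvatureFactor_mul_le_of_recursion
      (a := fun t => multilinearExt f (fun p => X t (owner p) p) - f ∅) hc0 hc1 hT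
      (mul_nonneg hpos hB0) (by
        have : (fun p => X 0 (owner p) p) = 0 := by
          funext p
          rw [h.init]
        simp [this, multilinearExt_zero_vector]) hrec
    -- The recursion controls F - f(∅); the offset f(∅) is restored because the overall factor is at
    -- most 1.
    have h1 : curvatureFactor c * (1 - ε) * f ∅ ≤ f ∅ :=
      mul_le_of_le_one_left (hf_nonneg ∅) (mul_le_one₀ hφ1 hpos (by linarith))
    linarith

end Deterministic

/-! ### Hoeffding's inequality for finite weights -/

section Hoeffding

theorem sum_union_le {ι : Type*} [DecidableEq ι] {h : ι → ℝ} (hh : ∀ a, 0 ≤ h a)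
    (s t : Finset ι) : ∑ a ∈ s ∪ t, h a ≤ ∑ a ∈ s, h a + ∑ a ∈ t, h a := by
  rw [← Finset.sum_union_inter]
  exact le_add_of_nonneg_right (Finset.sum_nonneg fun a _ => hh a)

theorem sum_biUnion_le {ι β : Type*} [DecidableEq ι] {h : ι → ℝ} (hh : ∀ a, 0 ≤ h a)
    (s : Finset β) (t : β → Finset ι) :
    ∑ a ∈ s.biUnion t, h a ≤ ∑ b ∈ s, ∑ a ∈ t b, h a := by
  classical
  induction s using Finset.induction_on with
  | empty => simp
  | insert b s hb ih =>
    rw [Finset.biUnion_insert, Finset.sum_insert hb]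
    exact (sum_union_le hh _ _).trans (add_le_add_right ih _)

variable {α : Type*} [Fintype α] {w Y : α → ℝ} {l u : ℝ}

/-- Hoeffding's lemma for a finite probability distribution given by its weights. -/
theorem sum_mul_exp_le (hw : ∀ a, 0 ≤ w a) (hw1 : ∑ a, w a = 1)
    (hY : ∀ a, Y a ∈ Set.Icc l u) (s : ℝ) :
    ∑ a, w a * Real.exp (s * (Y a - ∑ b, w b * Y b)) ≤ Real.exp (s ^ 2 * (u - l) ^ 2 / 8) := by
  let _ : MeasurableSpace α := ⊤
  have : MeasurableSingletonClass α := ⟨fun _ => trivial⟩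
  let p : PMF α := PMF.ofFintype (fun a => ENNReal.ofReal (w a)) (by
    rw [← ENNReal.ofReal_sum_of_nonneg fun a _ => hw a, hw1, ENNReal.ofReal_one])
  have hint : ∀ h : α → ℝ, ∫ a, h a ∂p.toMeasure = ∑ a, w a * h a := fun h => by
    rw [PMF.integral_eq_sum]
    refine Finset.sum_congr rfl fun a _ => ?_
    simp [p, ENNReal.toReal_ofReal (hw a)]
  have hmeas : AEMeasurable Y p.toMeasure := (measurable_from_top : Measurable Y).aemeasurable
  have h := (hasSubgaussianMGF_of_mem_Icc hmeas (Filter.Eventually.of_forall hY)).mgf_le s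
  rw [mgf, hint, hint] at h
  refine h.trans_eq (congrArg _ ?_)
  push_cast
  rw [div_pow, Real.norm_eq_abs, sq_abs]
  ring

theorem sum_pi_prod_eq_pow (K : ℕ) (h : α → ℝ) :
    ∑ S : Fin K → α, ∏ k, h (S k) = (∑ a, h a) ^ K := by
  classical
  have := Finset.prod_univ_sum (fun _ : Fin K => (Finset.univ : Finset α)) fun _ a => h a
  rw [Fintype.piFinset_univ] at this
  rw [← this]
  simp

open scoped Classical in
/-- Hoeffding's inequality for independent samples, as a sum of weights. -/
theorem sum_prod_upper_tail_le (hw : ∀ a, 0 ≤ w a) (hw1 : ∑ a, w a = 1)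
    (hY : ∀ a, Y a ∈ Set.Icc l u) (hlu : l < u) (K : ℕ) {ε : ℝ} (hε : 0 ≤ ε) :
    ∑ S : Fin K → α with K * ((u - l) * ε) < ∑ k, (Y (S k) - ∑ b, w b * Y b), ∏ k, w (S k)
      ≤ Real.exp (-2 * K * ε ^ 2) := by
  set m := ∑ b, w b * Y b with hm
  have hul : 0 < u - l := sub_pos.2 hlu
  -- The minimizer of the Chernoff exponent K (s² (u - l)²/8 - s (u - l) ε), whose value there is
  -- -2Kε².
  set s := 4 * ε / (u - l) with hs
  have hs0 : 0 ≤ s := by positivity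
  have hpt : ∀ S : Fin K → α, 0 ≤ ∏ k, w (S k) * Real.exp (s * (Y (S k) - m)) := fun S =>
    Finset.prod_nonneg fun k _ => mul_nonneg (hw _) (Real.exp_nonneg _)
  calc ∑ S : Fin K → α with K * ((u - l) * ε) < ∑ k, (Y (S k) - m), ∏ k, w (S k)
      ≤ ∑ S : Fin K → α with K * ((u - l) * ε) < ∑ k, (Y (S k) - m),
          Real.exp (-(s * (K * ((u - l) * ε)))) *
            ∏ k, w (S k) * Real.exp (s * (Y (S k) - m)) := by
        refine Finset.sum_le_sum fun S hS => ?_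
        have hS' := (Finset.mem_filter.1 hS).2
        rw [Finset.prod_mul_distrib, ← Real.exp_sum, ← Finset.mul_sum, mul_left_comm,
          ← Real.exp_add]
        refine le_mul_of_one_le_right (Finset.prod_nonneg fun k _ => hw _) (Real.one_le_exp ?_)
        linarith [mul_le_mul_of_nonneg_left hS'.le hs0]
    _ ≤ ∑ S : Fin K → α, Real.exp (-(s * (K * ((u - l) * ε)))) *
          ∏ k, w (S k) * Real.exp (s * (Y (S k) - m)) :=
        Finset.sum_le_sum_of_subset_of_nonneg (Finset.filter_subset _ _)
          fun S _ _ => mul_nonneg (Real.exp_nonneg _) (hpt S)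
    _ = Real.exp (-(s * (K * ((u - l) * ε)))) *
          (∑ a, w a * Real.exp (s * (Y a - m))) ^ K := by
        rw [← Finset.mul_sum, sum_pi_prod_eq_pow K fun a => w a * Real.exp (s * (Y a - m))]
    _ ≤ Real.exp (-(s * (K * ((u - l) * ε)))) * Real.exp (s ^ 2 * (u - l) ^ 2 / 8) ^ K := by
        refine mul_le_mul_of_nonneg_left (pow_le_pow_left₀ (Finset.sum_nonneg fun a _ =>
          mul_nonneg (hw a) (Real.exp_nonneg _)) (sum_mul_exp_le hw hw1 hY s) K)
          (Real.exp_nonneg _)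
    _ = Real.exp (-2 * K * ε ^ 2) := by
        rw [← Real.exp_nat_mul, ← Real.exp_add, hs]
        congr 1
        field_simp
        ring

end Hoeffding

/-! ### Probability that the samples are accurate -/

section Sampling

variable {P : Type*} [Fintype P] [DecidableEq P] {f : Finset P → ℝ}

/-- The samples `S` estimate the gradient of the multilinear extension at `x` accurately in all
the coordinates of `N`. -/
def AccurateOn (f : Finset P → ℝ) (T : ℕ) (N : Finset P) {K : ℕ} (x : P → ℝ)
    (S : Fin K → Finset P) : Prop :=
  ∀ p ∈ N, |empiricalGrad f S p - multilinearExt (discreteDeriv f p) x|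
    ≤ 1 / (2 * (T : ℝ)) * marginal f p ∅

/-- Bernoulli's inequality for (1 + 2q)^n gives (1 - 2q)^n ≤ 1/(1 + 2nq), which is at most 1 - nq
when 2nq ≤ 1; finally 2q⁴ ≤ q since q ≤ 1/2. -/
theorem pow_le_one_sub_mul_pow_four {q : ℝ} (hq : 0 ≤ q) {n : ℕ} (hn : 1 ≤ n)
    (h : 2 * n * q ≤ 1) : (1 - 2 * q) ^ n ≤ 1 - n * (2 * q ^ 4) := by
  have hn1 : (1 : ℝ) ≤ n := by exact_mod_cast hn
  have hy0 : 0 ≤ 2 * n * q := by positivity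
  have hq2 : q ≤ 1 / 2 := by nlinarith
  have h1 : 1 + n * (2 * q) ≤ (1 + 2 * q) ^ n := one_add_mul_le_pow (by linarith) n
  have h2 : (1 - 2 * q) ^ n * (1 + 2 * q) ^ n ≤ 1 := by
    rw [← mul_pow]
    exact pow_le_one₀ (by nlinarith) (by nlinarith)
  have h3 : 0 ≤ (1 - 2 * q) ^ n := pow_nonneg (by linarith) n
  have h4 : (1 - 2 * q) ^ n * (1 + 2 * n * q) ≤ (1 - n * q) * (1 + 2 * n * q) := by
    nlinarith [mul_le_mul_of_nonneg_left h1 h3]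
  have h5 : (1 - 2 * q) ^ n ≤ 1 - n * q := le_of_mul_le_mul_right h4 (by linarith)
  have h6 : 2 * q ^ 4 ≤ q := by
    have : q ^ 3 ≤ (1 / 2) ^ 3 := pow_le_pow_left₀ hq hq2 3
    nlinarith
  nlinarith

open scoped Classical in
theorem sum_inaccurate_le (hf_mono : Monotone f) (hf_sub : IsSubmodular f) {T K : ℕ}
    (hT : 1 ≤ T) (hK : 1 ≤ K) {x : P → ℝ} (hx : ∀ p, x p ∈ Set.Icc (0 : ℝ) 1) (p : P) :
    ∑ S : Fin K → Finset P with ¬ AccurateOn f T {p} x S, ∏ k, setProb x (S k)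
      ≤ 2 * Real.exp (-(1 / (8 * (T : ℝ) ^ 2)) * K) ^ 4 := by
  have hT0 : (0 : ℝ) < T := by exact_mod_cast hT
  have hK0 : (0 : ℝ) < K := by exact_mod_cast hK
  have hD : ∀ R, discreteDeriv f p R ∈ Set.Icc 0 (marginal f p ∅) := fun R => by
    rw [discreteDeriv_eq_marginal]
    exact ⟨marginal_nonneg hf_mono _ _, hf_sub.marginal_le (Finset.notMem_erase p R)⟩
  set m := multilinearExt (discreteDeriv f p) x with hm
  have hm1 : m = ∑ R, setProb x R * discreteDeriv f p R :=
    Finset.sum_congr rfl fun R _ => mul_comm _ _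
  have hgrad : ∀ S : Fin K → Finset P,
      empiricalGrad f S p - m = (∑ k, (discreteDeriv f p (S k) - m)) / K := fun S => by
    rw [Finset.sum_sub_distrib, Finset.sum_const, Finset.card_univ, Fintype.card_fin,
      nsmul_eq_mul, sub_div, mul_div_cancel_left₀ _ hK0.ne']
    rfl
  -- With zero singleton value all derivatives vanish and the estimate is exact; Hoeffding needs an
  -- interval of positive length.
  rcases (marginal_nonneg hf_mono p ∅).eq_or_lt with h0 | h0
  · have hz : ∀ R, discreteDeriv f p R = 0 := fun R =>
      le_antisymm ((hD R).2.trans_eq h0.symm) (hD R).1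
    have hm0 : m = 0 := by rw [hm1]; simp [hz]
    rw [Finset.filter_false_of_mem]
    · simp only [Finset.sum_empty]
      positivity
    · intro S _
      rw [not_not]
      intro q hq
      rw [Finset.mem_singleton] at hq
      subst hq
      rw [← hm, hgrad, ← h0, hm0]
      simp [hz]
  · set a := marginal f p ∅ with ha
    have hexp : Real.exp (-2 * K * (1 / (2 * (T : ℝ))) ^ 2)
        = Real.exp (-(1 / (8 * (T : ℝ) ^ 2)) * K) ^ 4 := by
      rw [← Real.exp_nat_mul]
      congr 1
      push_cast
      field_simp
      norm_num
    have hup := sum_prod_upper_tail_le (setProb_nonneg hx) (sum_setProb x) hD h0 K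
      (ε := 1 / (2 * (T : ℝ))) (by positivity)
    -- The lower tail is the upper tail of the negated derivative.
    have hlo := sum_prod_upper_tail_le (Y := fun R => -discreteDeriv f p R) (l := -a) (u := 0)
      (setProb_nonneg hx) (sum_setProb x)
      (fun R => ⟨neg_le_neg (hD R).2, neg_nonpos.2 (hD R).1⟩) (neg_neg_iff_pos.2 h0) K
      (ε := 1 / (2 * (T : ℝ))) (by positivity)
    rw [hexp] at hup hlo
    have hpos : ∀ S : Fin K → Finset P, 0 ≤ ∏ k, setProb x (S k) := fun S =>
      Finset.prod_nonneg fun k _ => setProb_nonneg hx _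
    refine le_trans ?_ ((add_le_add hup hlo).trans_eq (two_mul _).symm)
    refine le_trans (Finset.sum_le_sum_of_subset_of_nonneg ?_ fun S _ _ => hpos S)
      (sum_union_le hpos _ _)
    intro S hS
    rw [Finset.mem_filter] at hS
    have hS' := hS.2
    simp only [AccurateOn, Finset.mem_singleton, forall_eq, not_le] at hS'
    rw [← hm, ← ha, hgrad, lt_abs, lt_div_iff₀ hK0, ← neg_div, lt_div_iff₀ hK0,
      ← Finset.sum_neg_distrib] at hS'
    simp only [Finset.mem_union, Finset.mem_filter, Finset.mem_univ, true_and, mul_neg,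
      Finset.sum_neg_distrib, ← hm1]
    refine hS'.imp (fun h => ?_) (fun h => ?_)
    · linarith
    · simp only [neg_sub] at h
      simp only [sub_neg_eq_add, zero_add, neg_add_eq_sub]
      linarith

open scoped Classical in
theorem le_sum_accurateOn (hf_mono : Monotone f) (hf_sub : IsSubmodular f) {T K : ℕ}
    (hT : 1 ≤ T) (hK : 1 ≤ K) {x : P → ℝ} (hx : ∀ p, x p ∈ Set.Icc (0 : ℝ) 1)
    {N : Finset P} (hN : 1 ≤ N.card)
    (hlarge : 2 * (N.card : ℝ) * Real.exp (-(1 / (8 * (T : ℝ) ^ 2)) * K) ≤ 1) :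
    (1 - 2 * Real.exp (-(1 / (8 * (T : ℝ) ^ 2)) * K)) ^ N.card ≤
      ∑ S : Fin K → Finset P with AccurateOn f T N x S, ∏ k, setProb x (S k) := by
  have hpos : ∀ S : Fin K → Finset P, 0 ≤ ∏ k, setProb x (S k) := fun S =>
    Finset.prod_nonneg fun k _ => setProb_nonneg hx _
  have htot := Finset.sum_filter_add_sum_filter_not Finset.univ
    (fun S : Fin K → Finset P => AccurateOn f T N x S) fun S => ∏ k, setProb x (S k)
  rw [sum_pi_prod_eq_pow, sum_setProb, one_pow] at htot
  have hbad : ∑ S : Fin K → Finset P with ¬ AccurateOn f T N x S, ∏ k, setProb x (S k)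
      ≤ N.card * (2 * Real.exp (-(1 / (8 * (T : ℝ) ^ 2)) * K) ^ 4) := by
    rw [← nsmul_eq_mul, ← Finset.sum_const]
    refine le_trans ?_ (Finset.sum_le_sum fun p _ => sum_inaccurate_le hf_mono hf_sub hT hK hx p)
    refine le_trans (Finset.sum_le_sum_of_subset_of_nonneg (t := N.biUnion fun p =>
      {S : Fin K → Finset P | ¬ AccurateOn f T {p} x S}) ?_ fun S _ _ => hpos S)
      (sum_biUnion_le hpos _ _)
    intro S hS
    have hS' := (Finset.mem_filter.1 hS).2
    simp only [AccurateOn, not_forall] at hS'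
    obtain ⟨p, hp, hpS⟩ := hS'
    simp only [Finset.mem_biUnion, Finset.mem_filter, Finset.mem_univ, true_and]
    exact ⟨p, hp, fun h => hpS (h p (Finset.mem_singleton_self p))⟩
  linarith [pow_le_one_sub_mul_pow_four (Real.exp_nonneg _) hN hlarge]

variable {A : Type*} [Fintype A] [DecidableEq A]

open scoped Classical in
-- The agents' samples are independent, so the weight of the joint event factors over the agents.
theorem prod_le_sum_accurateOn (hf_mono : Monotone f) (hf_sub : IsSubmodular f) {T : ℕ}
    (hT : 1 ≤ T) {K : A → ℕ} (hK : ∀ i, 1 ≤ K i) {x : A → P → ℝ}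
    (hx : ∀ i p, x i p ∈ Set.Icc (0 : ℝ) 1) {N : A → Finset P} (hN : ∀ i, 1 ≤ (N i).card)
    (hlarge : ∀ i, 2 * ((N i).card : ℝ) * Real.exp (-(1 / (8 * (T : ℝ) ^ 2)) * K i) ≤ 1) :
    ∏ i, (1 - 2 * Real.exp (-(1 / (8 * (T : ℝ) ^ 2)) * K i)) ^ (N i).card ≤
      ∑ S : (i : A) → Fin (K i) → Finset P with ∀ i, AccurateOn f T (N i) (x i) (S i),
        ∏ i, ∏ k, setProb (x i) (S i k) := by
  have h1 := Finset.prod_univ_sum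
    (fun i => {S : Fin (K i) → Finset P | AccurateOn f T (N i) (x i) S})
    fun i S => ∏ k, setProb (x i) (S k)
  have h2 : Fintype.piFinset
      (fun i => ({S : Fin (K i) → Finset P | AccurateOn f T (N i) (x i) S} : Finset _))
      = ({S : (i : A) → Fin (K i) → Finset P | ∀ i, AccurateOn f T (N i) (x i) (S i)} :
        Finset _) := by
    ext S
    simp
  rw [h2] at h1
  rw [← h1]
  refine Finset.prod_le_prod (fun i _ => pow_nonneg ?_ _) fun i _ =>
    le_sum_accurateOn hf_mono hf_sub hT (hK i) (hx i) (hN i) (hlarge i)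
  have h3 : (1 : ℝ) ≤ (N i).card := by exact_mod_cast hN i
  nlinarith [hlarge i, Real.exp_nonneg (-(1 / (8 * (T : ℝ) ^ 2)) * K i)]

end Sampling

/-! ### Conditioning on the history of a run -/

section Run

theorem continuous_multilinearExt {P : Type*} [Fintype P] [DecidableEq P] (h : Finset P → ℝ) :
    Continuous (multilinearExt h) := by
  unfold multilinearExt setProb
  fun_prop

theorem measurable_neighborMax {A P Ω : Type*} [Countable A] {m : MeasurableSpace Ω}
    (G : SimpleGraph A) {y : Ω → A → P → ℝ} (hy : ∀ j p, Measurable fun ω => y ω j p) (i : A) :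
    Measurable fun ω => neighborMax G (y ω) i :=
  measurable_pi_lambda _ fun p => Measurable.iSup fun j => hy j p

theorem measurableSet_accurateOn {P Ω : Type*} [Fintype P] [DecidableEq P]
    {m : MeasurableSpace Ω} (f : Finset P → ℝ) (T : ℕ) (N : Finset P) {K : ℕ} {y : Ω → P → ℝ}
    (hy : Measurable y) (S : Fin K → Finset P) : MeasurableSet {ω | AccurateOn f T N (y ω) S} := by
  simp only [AccurateOn, Set.ofPred_forall]
  exact MeasurableSet.iInter fun p => MeasurableSet.iInter fun _ =>
    measurableSet_le
      (measurable_const.sub ((continuous_multilinearExt _).measurable.comp hy)).abs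
      measurable_const

variable {A P Ω : Type*} [Fintype A] [Fintype P] [DecidableEq P] [MeasurableSpace Ω]
  {μ : Measure Ω} {ℱ : Filtration ℕ ‹MeasurableSpace Ω›} {G : SimpleGraph A} {owner : P → A}
  {κ : A → ℕ} {f : Finset P → ℝ} {T : ℕ} {K : A → ℕ} {x : ℕ → A → Ω → P → ℝ}
  {R : ℕ → (i : A) → Fin (K i) → Ω → Finset P} {v : ℕ → A → Ω → P → ℝ}

namespace IsRun

theorem isTrajectory (h : IsRun μ ℱ G owner κ f T K x R v) (ω : Ω) :
    IsTrajectory G owner κ T (fun t i => x t i ω) (fun t i => v t i ω) :=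
  ⟨fun i => h.init i ω, fun t ht i => h.direction_mem t ht i ω, fun t ht i => h.update t ht i ω⟩

theorem measurable_state (h : IsRun μ ℱ G owner κ f T K x R v) {t : ℕ} (ht : t ≤ T) (i : A) :
    Measurable[ℱ t] (x t i) := by
  induction t generalizing i with
  | zero =>
    rw [show x 0 i = fun _ => 0 from funext fun ω => h.init i ω]
    exact @measurable_const _ _ _ (ℱ 0) 0
  | succ t ih =>
    rw [show x (t + 1) i = fun ω => neighborMax G
      (fun j p => x t j ω p + (1 / (T : ℝ)) * v t j ω p) i from funext fun ω => h.update t ht i ω]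
    refine measurable_neighborMax G (fun j p => ?_) i
    have h1 : Measurable[ℱ (t + 1)] (x t j) := (ih (by omega) j).mono (ℱ.mono (Nat.le_succ t)) le_rfl
    exact ((measurable_pi_apply p).comp h1).add
      (((measurable_pi_apply p).comp (h.direction_meas t ht j)).const_mul _)

/-- The outcomes for which all the agents' samples of step `t` are accurate in the agents' own
strategies. -/
def accurateEvent [DecidableEq A] (owner : P → A) (f : Finset P → ℝ) (T : ℕ)
    (x : ℕ → A → Ω → P → ℝ) (R : ℕ → (i : A) → Fin (K i) → Ω → Finset P) (t : ℕ) : Set Ω :=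
  {ω | ∀ i, AccurateOn f T (strategySet owner i) (x t i ω) fun k => R t i k ω}

theorem measurableSet_accurateOn [DecidableEq A] (h : IsRun μ ℱ G owner κ f T K x R v) {t : ℕ}
    (ht : t ≤ T) (S : (i : A) → Fin (K i) → Finset P) :
    MeasurableSet[ℱ t] {ω | ∀ i, AccurateOn f T (strategySet owner i) (x t i ω) (S i)} := by
  simp only [Set.ofPred_forall]
  exact MeasurableSet.iInter fun i =>
    DistSubmod.measurableSet_accurateOn f T _ (h.measurable_state ht i) (S i)

theorem measurableSet_samples (h : IsRun μ ℱ G owner κ f T K x R v) {t : ℕ} (ht : t < T)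
    (S : (i : A) → Fin (K i) → Finset P) :
    MeasurableSet[ℱ (t + 1)] {ω | ∀ i k, R t i k ω = S i k} := by
  simp only [Set.ofPred_forall]
  exact MeasurableSet.iInter fun i => MeasurableSet.iInter fun k => h.sample_meas t ht i k _

omit [Fintype A] [MeasurableSpace Ω] in
theorem accurateEvent_eq_iUnion [DecidableEq A] (t : ℕ) :
    accurateEvent owner f T x R t = ⋃ S : (i : A) → Fin (K i) → Finset P,
      {ω | ∀ i, AccurateOn f T (strategySet owner i) (x t i ω) (S i)} ∩
        {ω | ∀ i k, R t i k ω = S i k} := by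
  ext ω
  simp only [Set.mem_iUnion, Set.mem_inter_iff, Set.mem_ofPred_eq]
  constructor
  · exact fun hω => ⟨fun i k => R t i k ω, hω, fun _ _ => rfl⟩
  · rintro ⟨S, hS, hR⟩ i
    have : (fun k => R t i k ω) = S i := funext (hR i)
    rw [this]
    exact hS i

theorem measurableSet_accurateEvent [DecidableEq A] (h : IsRun μ ℱ G owner κ f T K x R v)
    {t : ℕ} (ht : t < T) : MeasurableSet[ℱ (t + 1)] (accurateEvent owner f T x R t) := by
  rw [accurateEvent_eq_iUnion]
  exact MeasurableSet.iUnion fun S => MeasurableSet.inter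
    (ℱ.mono (Nat.le_succ t) _ (h.measurableSet_accurateOn ht.le S)) (h.measurableSet_samples ht S)

variable [IsProbabilityMeasure μ]

/-- Given any event of the history, the samples of step `t` are accurate with probability at
least `Q`, if they are for every fixed state of the agents. -/
theorem mul_le_measureReal_inter_accurateEvent [DecidableEq A]
    (h : IsRun μ ℱ G owner κ f T K x R v) {t : ℕ} (ht : t < T) {Q : ℝ}
    (hQ : ∀ y : A → P → ℝ, (∀ i p, y i p ∈ Set.Icc (0 : ℝ) 1) → open scoped Classical in
      Q ≤ ∑ S : (i : A) → Fin (K i) → Finset P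
        with ∀ i, AccurateOn f T (strategySet owner i) (y i) (S i), ∏ i, ∏ k, setProb (y i) (S i k))
    {E : Set Ω} (hE : MeasurableSet[ℱ t] E) :
    Q * μ.real E ≤ μ.real (E ∩ accurateEvent owner f T x R t) := by
  classical
  set D : ((i : A) → Fin (K i) → Finset P) → Set Ω := fun S =>
    {ω | ∀ i, AccurateOn f T (strategySet owner i) (x t i ω) (S i)} with hD
  set W : ((i : A) → Fin (K i) → Finset P) → Ω → ℝ := fun S ω =>
    ∏ i, ∏ k, setProb (x t i ω) (S i k) with hW
  have hDF : ∀ S, MeasurableSet[ℱ t] (D S) := h.measurableSet_accurateOn ht.le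
  have hDm : ∀ S, MeasurableSet (D S) := fun S => ℱ.le t _ (hDF S)
  have hEm : MeasurableSet E := ℱ.le t _ hE
  have hx : ∀ ω i p, x t i ω p ∈ Set.Icc (0 : ℝ) 1 := fun ω => (h.isTrajectory ω).mem_Icc ht.le
  have hWm : ∀ S, Measurable (W S) := fun S => by
    have hc : ∀ U : Finset P, Continuous fun y : P → ℝ => setProb y U := fun U => by
      unfold setProb
      fun_prop
    exact Finset.measurable_prod _ fun i _ => Finset.measurable_prod _ fun k _ =>
      (hc (S i k)).measurable.comp ((h.measurable_state ht.le i).mono (ℱ.le t) le_rfl)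
  have hle1 : ∀ (y : P → ℝ), (∀ p, y p ∈ Set.Icc (0 : ℝ) 1) → ∀ U, setProb y U ≤ 1 :=
    fun y hy U => by
      rw [← sum_setProb y]
      exact Finset.single_le_sum (fun V _ => setProb_nonneg hy V) (Finset.mem_univ U)
  have hWI : ∀ S, Integrable (W S) μ := fun S =>
    Integrable.of_mem_Icc 0 1 (hWm S).aemeasurable (Filter.Eventually.of_forall fun ω =>
      ⟨Finset.prod_nonneg fun i _ => Finset.prod_nonneg fun k _ => setProb_nonneg (hx ω i) _,
        Finset.prod_le_one (fun i _ => Finset.prod_nonneg fun k _ => setProb_nonneg (hx ω i) _)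
          fun i _ => Finset.prod_le_one (fun k _ => setProb_nonneg (hx ω i) _)
            fun k _ => hle1 _ (hx ω i) _⟩)
  have hI : ∀ S, IntegrableOn ((D S).indicator (W S)) E μ := fun S =>
    ((hWI S).indicator (hDm S)).integrableOn
  -- Splitting by sample values S leaves an accuracy condition `D S` on the current state alone. It
  -- belongs to the history, so the sampling law applies to `E ∩ D S`.
  have hmeas : μ.real (E ∩ accurateEvent owner f T x R t)
      = ∫ ω in E, ∑ S, (D S).indicator (W S) ω ∂μ := by
    rw [accurateEvent_eq_iUnion, Set.inter_iUnion, measureReal_iUnion_fintype,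
      integral_finsetSum _ fun S _ => hI S]
    · refine Finset.sum_congr rfl fun S _ => ?_
      rw [← Set.inter_assoc, setIntegral_indicator (hDm S)]
      exact h.sample_law t ht _ (hE.inter (hDF S)) S
    · intro S S' hSS'
      refine Set.disjoint_left.2 fun ω hω hω' => hSS' ?_
      funext i k
      exact (hω.2.2 i k).symm.trans (hω'.2.2 i k)
    · exact fun S => hEm.inter ((hDm S).inter (ℱ.le (t + 1) _ (h.measurableSet_samples ht S)))
  rw [hmeas]
  have hconst : Q * μ.real E = ∫ _ in E, Q ∂μ := by
    rw [setIntegral_const, smul_eq_mul, mul_comm]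
  rw [hconst]
  refine integral_mono (integrable_const Q) (integrable_finsetSum _ fun S _ => hI S) fun ω => ?_
  refine (hQ (fun i => x t i ω) (hx ω)).trans_eq ?_
  rw [Finset.sum_filter]
  refine Finset.sum_congr (by congr) fun S _ => ?_
  simp only [Set.indicator_apply, hD, hW, Set.mem_ofPred_eq]

theorem pow_le_measureReal_iInter_accurateEvent [DecidableEq A]
    (h : IsRun μ ℱ G owner κ f T K x R v) {Q : ℝ} (hQ0 : 0 ≤ Q)
    (hQ : ∀ y : A → P → ℝ, (∀ i p, y i p ∈ Set.Icc (0 : ℝ) 1) → open scoped Classical in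
      Q ≤ ∑ S : (i : A) → Fin (K i) → Finset P
        with ∀ i, AccurateOn f T (strategySet owner i) (y i) (S i), ∏ i, ∏ k, setProb (y i) (S i k))
    {t : ℕ} (ht : t ≤ T) :
    MeasurableSet[ℱ t] {ω | ∀ s < t, ω ∈ accurateEvent owner f T x R s} ∧
      Q ^ t ≤ μ.real {ω | ∀ s < t, ω ∈ accurateEvent owner f T x R s} := by
  induction t with
  | zero => simp
  | succ t ih =>
    obtain ⟨hm, hp⟩ := ih (by omega)
    have heq : {ω | ∀ s < t + 1, ω ∈ accurateEvent owner f T x R s} =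
        {ω | ∀ s < t, ω ∈ accurateEvent owner f T x R s} ∩ accurateEvent owner f T x R t := by
      ext ω
      simp only [Set.mem_ofPred_eq, Set.mem_inter_iff, Nat.forall_lt_succ_right]
    rw [heq]
    refine ⟨MeasurableSet.inter (ℱ.mono (Nat.le_succ t) _ hm)
      (h.measurableSet_accurateEvent ht), ?_⟩
    refine le_trans ?_ (h.mul_le_measureReal_inter_accurateEvent ht hQ hm)
    rw [pow_succ']
    exact mul_le_mul_of_nonneg_left hp hQ0

end IsRun

end Run

end DistSubmod

/-! ### Accurate outcomes satisfy the guarantee -/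

theorem mainTheorem2
    {A P Ω : Type*} [Fintype A] [DecidableEq A] [Fintype P] [DecidableEq P]
    [MeasurableSpace Ω] (μ : MeasureTheory.Measure Ω) [MeasureTheory.IsProbabilityMeasure μ]
    (ℱ : MeasureTheory.Filtration ℕ ‹MeasurableSpace Ω›)
    (G : SimpleGraph A) (hG : G.Connected)
    (owner : P → A) (κ : A → ℕ)
    (hκ : ∀ i, 1 ≤ κ i ∧ κ i ≤ (DistSubmod.strategySet owner i).card)
    (f : Finset P → ℝ) (hf_nonneg : ∀ S, 0 ≤ f S) (hf_mono : Monotone f)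
    (hf_sub : DistSubmod.IsSubmodular f)
    (Rstar : Finset P) (hRstar : DistSubmod.IsOptimizer owner κ f Rstar)
    (T : ℕ) (hT : 1 ≤ T) (K : A → ℕ) (hK : ∀ i, 1 ≤ K i)
    (hKlarge : ∀ i, 2 * ((DistSubmod.strategySet owner i).card : ℝ)
      * Real.exp (-(1 / (8 * (T : ℝ) ^ 2)) * K i) ≤ 1)
    (x : ℕ → A → Ω → P → ℝ) (R : ℕ → (i : A) → Fin (K i) → Ω → Finset P)
    (v : ℕ → A → Ω → P → ℝ)
    (hrun : DistSubmod.IsRun μ ℱ G owner κ f T K x R v)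
    (c : ℝ) (hc : c = DistSubmod.curvature f)
    (κtot : ℝ) (hκtot : κtot = ∑ i, (κ i : ℝ)) :
    (∏ i, (1 - 2 * Real.exp (-(1 / (8 * (T : ℝ) ^ 2)) * K i))
        ^ (DistSubmod.strategySet owner i).card) ^ T
      ≤ μ.real {ω | DistSubmod.curvatureFactor c
          * (1 - (2 * c * κtot * G.diam + c * κtot / 2 + 1) * (κtot / T)) * f Rstar
          ≤ DistSubmod.multilinearExt f
              (DistSubmod.agentMax (fun i => x T i ω))} := by

  have hcard : ∀ i, 1 ≤ (DistSubmod.strategySet owner i).card := fun i =>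
    (hκ i).1.trans (hκ i).2
  obtain ⟨i₀⟩ := hG.nonempty
  obtain ⟨p₀, _⟩ := Finset.card_pos.1 (hcard i₀)
  have : Nonempty P := ⟨p₀⟩
  have hQ0 : 0 ≤ ∏ i, (1 - 2 * Real.exp (-(1 / (8 * (T : ℝ) ^ 2)) * K i))
      ^ (DistSubmod.strategySet owner i).card := by
    refine Finset.prod_nonneg fun i _ => pow_nonneg ?_ _
    have h1 : (1 : ℝ) ≤ (DistSubmod.strategySet owner i).card := by exact_mod_cast hcard i
    nlinarith [hKlarge i, Real.exp_nonneg (-(1 / (8 * (T : ℝ) ^ 2)) * K i)]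
  refine (hrun.pow_le_measureReal_iInter_accurateEvent hQ0 (fun y hy =>
    DistSubmod.prod_le_sum_accurateOn hf_mono hf_sub hT hK hy hcard hKlarge) le_rfl).2.trans
      (measureReal_mono fun ω hω => ?_)
  rw [Set.mem_ofPred_eq, hc, hκtot]
  exact (hrun.isTrajectory ω).guarantee
    (g := fun t i => DistSubmod.empiricalGrad f fun k => R t i k ω) hG (fun i => (hκ i).1)
    hf_nonneg hf_mono hf_sub DistSubmod.curvature_nonneg hRstar hT
    (fun t ht p => hω t ht (owner p) p (by simp [DistSubmod.strategySet]))
    (fun t ht i => hrun.direction_max t ht i ω)
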